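/- A (nondeterministic B\"uchi) automaton is a tuple $\mathcal{A}=\langle\Sigma,Q,\delta,Q_0,\alpha\rangle$, where $\Sigma$ is a finite alphabet, $Q$ is a finite set of states, $\delta:Q\times\Sigma\to 2^Q$ is a transition function, $Q_0\subseteq Q$ is a set of initial states and $\alpha\subseteq Q$ is a set of accepting states. An infinite word $w=\sigma_1\sigma_2\cdots\in\Sigma^\omega$ is accepted by $\mathcal{A}$ if there is a sequence of states $q_0,q_1,\ldots$ with $q_0\in Q_0$ and $q_{i+1}\in\delta(q_i,\sigma_{i+1})$ for all $i\ge 0$ in which some state of $\alpha$ occurs infinitely often; $\mathfrak{L}(\mathcal{A})\subseteq\Sigma^\omega$ is the set of accepted words. For $w,w'\in\Sigma^\omega$ write $w\sim w'$ if every letter of $\Sigma$ has the same number of occurrences in $\{0,1,2,\ldots\}\cup\{\infty\}$ in $w$ and in $w'$. The jumping language of $\mathcal{A}$ is $$\mathfrak{J}(\mathcal{A})=\{w\in\Sigma^\omega \mid \text{there is } w'\sim w \text{ with } w'\in\mathfrak{L}(\mathcal{A})\}.$$ **Proposition.** For every automaton $\mathcal{A}$ over a finite alphabet $\Sigma$ there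 exists an automaton $\mathcal{B}$ over $\Sigma$ such that $\mathfrak{J}(\mathcal{B})=\Sigma^\omega\setminus\mathfrak{J}(\mathcal{A})$. -/

import Mathlib

/-!
An automaton over the finite alphabet `α` with finite state set `Q` is Mathlib's `NFA α Q`
(transition function, set of initial states, set of accepting states) together with `[Finite α]`
and `[Finite Q]`; here it reads infinite words `w : ℕ → α`, with the Büchi acceptance condition.
-/

namespace JumpingAutomata

universe u v

/-- `ρ` is a run of `A` on the infinite word `w`. The letters of `w` are indexed from `0`, so the
step from `ρ i` to `ρ (i + 1)` reads `w i`. -/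
def IsRun {α : Type u} {Q : Type v} (A : NFA α Q) (w : ℕ → α) (ρ : ℕ → Q) : Prop :=
  ρ 0 ∈ A.start ∧ ∀ i, ρ (i + 1) ∈ A.step (ρ i) (w i)

/-- The set of states that occur infinitely often in `ρ`. -/
def infStates {Q : Type v} (ρ : ℕ → Q) : Set Q :=
  {q | ∀ i : ℕ, ∃ j > i, ρ j = q}

/-- The language of infinite words accepted by `A` under the Büchi condition. -/
def omegaLanguage {α : Type u} {Q : Type v} (A : NFA α Q) : Set (ℕ → α) :=
  {w | ∃ ρ : ℕ → Q, IsRun A w ρ ∧ (infStates ρ ∩ A.accept).Nonempty}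

/-- The Parikh image of an infinite word: the number of occurrences of each letter, `⊤` if there
are infinitely many. -/
noncomputable def parikh {α : Type u} (w : ℕ → α) : α → ℕ∞ :=
  fun a => Set.encard {i : ℕ | w i = a}

/-- Two infinite words are permutations of each other if they have the same Parikh image. -/
def IsPermutation {α : Type u} (w w' : ℕ → α) : Prop :=
  parikh w = parikh w'

/-- The jumping language of `A`: the infinite words with a permutation accepted by `A`. -/
def jumpingLanguage {α : Type u} {Q : Type v} (A : NFA α Q) : Set (ℕ → α) :=
  {w | ∃ w' : ℕ → α, IsPermutation w' w ∧ w' ∈ omegaLanguage A}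

end JumpingAutomata

/-! Membership in a jumping language depends only on the Parikh image: the set `S` of letters
occurring infinitely often, nonempty by pigeonhole, and the finite counts off `S`.

For fixed `S`, the realized count vectors form a semilinear set (`isSemilinearSet_setOf_realizes`):
an accepting run splits into a finite prefix, whose vectors are governed by Parikh's theorem, and a
tail with only letters of `S`, whose existence depends only on the state reached. Semilinear sets
are closed under complement.

Conversely, for each nonempty `S₀`, a semilinear set of counts off `S₀` is realized by an automaton
(`isRecognizable_of_isSemilinearSet`). The union of these over the finitely many `S₀` gives the
complement. -/

namespace JumpingAutomata

open scoped Pointwise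

/-! ### Parikh's theorem for finite paths -/

section Paths

variable {α : Type*} {Q : Type*} [DecidableEq α]

/-- `PathIn A K p v q`: there is a nonempty path of `A` from `p` to `q` whose intermediate states
all lie in `K` and whose label has Parikh vector `v`. -/
inductive PathIn (A : NFA α Q) (K : Set Q) (p : Q) : (α → ℕ) → Q → Prop
  | single {a : α} {q : Q} : q ∈ A.step p a → PathIn A K p (Pi.single a 1) q
  | snoc {v : α → ℕ} {q r : Q} {a : α} :
      PathIn A K p v q → q ∈ K → r ∈ A.step q a → PathIn A K p (v + Pi.single a 1) r

/-- `Path A p v q`: there is a (possibly empty) path of `A` from `p` to `q` whose label has Parikh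
vector `v`. -/
inductive Path (A : NFA α Q) (p : Q) : (α → ℕ) → Q → Prop
  | nil : Path A p 0 p
  | snoc {v : α → ℕ} {q r : Q} {a : α} :
      Path A p v q → r ∈ A.step q a → Path A p (v + Pi.single a 1) r

variable {A : NFA α Q} {K K' : Set Q} {p q r : Q} {v w : α → ℕ}

theorem PathIn.mono (hK : K ⊆ K') (h : PathIn A K p v q) : PathIn A K' p v q := by
  induction h with
  | single h => exact .single h
  | snoc _ hq hr ih => exact .snoc ih (hK hq) hr

theorem PathIn.trans (h : PathIn A K p v q) (hq : q ∈ K) (h' : PathIn A K q w r) :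
    PathIn A K p (v + w) r := by
  induction h' with
  | single h' => exact .snoc h hq h'
  | snoc _ hq' hr ih => rw [← add_assoc]; exact .snoc ih hq' hr

theorem PathIn.add_closure (h : PathIn A K p v q) (hq : q ∈ K)
    (hw : w ∈ AddSubmonoid.closure {u | PathIn A K q u q}) : PathIn A K p (v + w) q := by
  induction hw using AddSubmonoid.closure_induction_right with
  | zero => simpa using h
  | add_right x _ y hy ih => rw [← add_assoc]; exact ih.trans hq hy

/-- Kleene's decomposition: cut a path at its visits to `k`. Vectors add commutatively, so the star
of the loops at `k` becomes an additive closure. -/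
theorem setOf_pathIn_insert (A : NFA α Q) (K : Set Q) (k p q : Q) :
    {v | PathIn A (insert k K) p v q} = {v | PathIn A K p v q} ∪
      ({v | PathIn A K p v k} + (AddSubmonoid.closure {v | PathIn A K k v k} : Set (α → ℕ)) +
        {v | PathIn A K k v q}) := by
  have hsub : K ⊆ insert k K := Set.subset_insert k K
  ext v
  constructor
  · intro h
    induction h with
    | single h => exact .inl (.single h)
    | @snoc v q r a _ hq hr ih =>
      rcases hq with rfl | hq
      · rcases ih with ih | ⟨_, ⟨x, hx, y, hy, rfl⟩, z, hz, rfl⟩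
        · refine .inr ⟨v, ⟨v, ih, 0, zero_mem _, add_zero _⟩, _, .single hr, rfl⟩
        · exact .inr ⟨_, ⟨x, hx, y + z,
            add_mem hy (AddSubmonoid.subset_closure hz), rfl⟩, _, .single hr, by
              simp [add_assoc]⟩
      · rcases ih with ih | ⟨_, ⟨x, hx, y, hy, rfl⟩, z, hz, rfl⟩
        · exact .inl (.snoc ih hq hr)
        · exact .inr ⟨_, ⟨x, hx, y, hy, rfl⟩, _, .snoc hz hq hr, by simp [add_assoc]⟩
  · rintro (h | ⟨_, ⟨x, hx, y, hy, rfl⟩, z, hz, rfl⟩)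
    · exact h.mono hsub
    · refine ((hx.mono hsub).add_closure (Set.mem_insert k K) ?_).trans (Set.mem_insert k K)
        (hz.mono hsub)
      exact AddSubmonoid.closure_mono (fun u hu => PathIn.mono hsub hu) hy

theorem isSemilinearSet_setOf_pathIn [Finite α] (A : NFA α Q) (hK : K.Finite) (p q : Q) :
    IsSemilinearSet {v | PathIn A K p v q} := by
  induction K, hK using Set.Finite.induction_on generalizing p q with
  | empty =>
    refine .of_finite ((Set.finite_range fun a : α => (Pi.single a 1 : α → ℕ)).subset ?_)
    rintro _ (h | ⟨_, h, _⟩)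
    · exact ⟨_, rfl⟩
    · exact h.elim
  | insert _ _ ih =>
    rw [setOf_pathIn_insert]
    exact (ih p q).union (((ih p _).add (ih _ _).closure).add (ih _ q))

theorem path_iff : Path A p v q ↔ p = q ∧ v = 0 ∨ PathIn A Set.univ p v q := by
  constructor
  · intro h
    induction h with
    | nil => exact .inl ⟨rfl, rfl⟩
    | snoc _ hr ih =>
      rcases ih with ⟨rfl, rfl⟩ | ih
      · rw [zero_add]; exact .inr (.single hr)
      · exact .inr (.snoc ih (Set.mem_univ _) hr)
  · rintro (⟨rfl, rfl⟩ | h)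
    · exact .nil
    · induction h with
      | single h => rw [← zero_add (Pi.single _ _)]; exact .snoc .nil h
      | snoc _ _ hr ih => exact .snoc ih hr

/-- Parikh's theorem for finite automata. -/
theorem isSemilinearSet_setOf_path [Finite α] [Finite Q] (A : NFA α Q) (p q : Q) :
    IsSemilinearSet {v | Path A p v q} := by
  simp_rw [path_iff]
  refine IsSemilinearSet.union (.of_finite ?_)
    (isSemilinearSet_setOf_pathIn A Set.finite_univ p q)
  exact (Set.finite_singleton 0).subset fun v hv => hv.2

theorem Path.trans (h : Path A p v q) (h' : Path A q w r) : Path A p (v + w) r := by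
  induction h' with
  | nil => simpa using h
  | snoc _ hr ih => rw [← add_assoc]; exact .snoc ih hr

end Paths

/-! ### Parikh images of infinite words -/

section Parikh

variable {α : Type*}

theorem parikh_eq_top_iff {w : ℕ → α} {a : α} : parikh w a = ⊤ ↔ ∀ n, ∃ i ≥ n, w i = a := by
  rw [parikh, Set.encard_eq_top_iff, ← Nat.frequently_atTop_iff_infinite,
    Filter.frequently_atTop]

theorem parikh_eq_zero_iff {w : ℕ → α} {a : α} : parikh w a = 0 ↔ ∀ i, w i ≠ a := by
  rw [parikh, Set.encard_eq_zero, Set.eq_empty_iff_forall_notMem]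
  rfl

/-- The Parikh vector with value `⊤` on `S` and values given by `x` elsewhere. -/
noncomputable def topOn (S : Set α) (x : α → ℕ) : α → ℕ∞ :=
  open Classical in fun a => if a ∈ S then ⊤ else (x a : ℕ∞)

theorem topOn_of_mem {S : Set α} {x : α → ℕ} {a : α} (h : a ∈ S) : topOn S x a = ⊤ := if_pos h

theorem topOn_of_notMem {S : Set α} {x : α → ℕ} {a : α} (h : a ∉ S) : topOn S x a = x a :=
  if_neg h

theorem topOn_eq_top_iff {S : Set α} {x : α → ℕ} {a : α} : topOn S x a = ⊤ ↔ a ∈ S := by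
  by_cases h : a ∈ S <;> simp [topOn, h]

theorem coe_add_topOn_zero {S : Set α} {x v : α → ℕ} (h : ∀ a ∉ S, v a = x a) :
    (fun a => (v a : ℕ∞)) + topOn S 0 = topOn S x := by
  ext1 a
  by_cases ha : a ∈ S
  · simp [topOn_of_mem ha]
  · simp [topOn_of_notMem ha, h a ha]

theorem parikh_eq_topOn (w : ℕ → α) :
    parikh w = topOn {a | parikh w a = ⊤} fun a => (parikh w a).toNat := by
  ext1 a
  by_cases ha : parikh w a = ⊤
  · rw [topOn_of_mem (S := {a | parikh w a = ⊤}) ha, ha]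
  · rw [topOn_of_notMem (S := {a | parikh w a = ⊤}) ha, ENat.natCast_toNat ha]

theorem exists_parikh_eq_top [Finite α] (w : ℕ → α) : {a | parikh w a = ⊤}.Nonempty := by
  obtain ⟨a, ha⟩ := Finite.exists_infinite_fiber w
  refine ⟨a, ?_⟩
  change parikh w a = ⊤
  rw [parikh, Set.encard_eq_top_iff]
  exact Set.infinite_coe_iff.mp ha

theorem parikh_eq_add_succ [DecidableEq α] (w : ℕ → α) :
    parikh w = Pi.single (w 0) 1 + parikh fun i => w (i + 1) := by
  ext1 a
  have hd : Disjoint {i | i = 0 ∧ w 0 = a} (Nat.succ '' {i | w (i + 1) = a}) := by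
    rw [Set.disjoint_left]
    rintro _ ⟨rfl, _⟩ ⟨j, _, hj⟩
    exact Nat.succ_ne_zero j hj
  have hu : {i | w i = a} = {i | i = 0 ∧ w 0 = a} ∪ Nat.succ '' {i | w (i + 1) = a} := by
    ext i
    cases i <;> simp
  rw [Pi.add_apply, parikh, parikh, hu, Set.encard_union_eq hd,
    Nat.succ_injective.encard_image]
  congr 1
  by_cases h : w 0 = a
  · subst h; simp
  · have h' : a ≠ w 0 := fun h' => h h'.symm
    simp [h, h']

/-- The projection of vectors that replaces the entries with index in `S` by `0`. -/
noncomputable def zeroOn (S : Set α) : (α → ℕ) →+ (α → ℕ) where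
  toFun x := Sᶜ.indicator x
  map_zero' := Set.indicator_zero _ _
  map_add' := Set.indicator_add _

theorem zeroOn_of_mem {S : Set α} {a : α} (x : α → ℕ) (h : a ∈ S) : zeroOn S x a = 0 :=
  Set.indicator_of_notMem (by simpa using h) _

theorem zeroOn_of_notMem {S : Set α} {a : α} (x : α → ℕ) (h : a ∉ S) : zeroOn S x a = x a :=
  Set.indicator_of_mem h _

theorem zeroOn_eq_zeroOn_iff {S : Set α} {x y : α → ℕ} :
    zeroOn S x = zeroOn S y ↔ ∀ a ∉ S, x a = y a := by
  constructor
  · intro h a ha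
    rw [← zeroOn_of_notMem x ha, h, zeroOn_of_notMem y ha]
  · intro h
    ext1 a
    by_cases ha : a ∈ S
    · rw [zeroOn_of_mem x ha, zeroOn_of_mem y ha]
    · rw [zeroOn_of_notMem x ha, zeroOn_of_notMem y ha, h a ha]

end Parikh

/-! ### Semilinearity of the realized vectors -/

section Acceptance

variable {α : Type*} {Q : Type*}

/-- Some infinite word with Parikh image `c` is accepted by `A` when started in the state `q`. -/
def AccFrom (A : NFA α Q) (q : Q) (c : α → ℕ∞) : Prop :=
  ∃ (w : ℕ → α) (ρ : ℕ → Q), ρ 0 = q ∧ (∀ i, ρ (i + 1) ∈ A.step (ρ i) (w i)) ∧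
    (infStates ρ ∩ A.accept).Nonempty ∧ parikh w = c

/-- `A` accepts a word in which exactly the letters of `S` occur infinitely often and every other
letter `a` occurs `x a` times. -/
def Realizes (A : NFA α Q) (S : Set α) (x : α → ℕ) : Prop :=
  ∃ p ∈ A.start, AccFrom A p (topOn S x)

theorem mem_jumpingLanguage_iff {A : NFA α Q} {w : ℕ → α} :
    w ∈ jumpingLanguage A ↔
      Realizes A {a | parikh w a = ⊤} fun a => (parikh w a).toNat := by
  rw [Realizes, ← parikh_eq_topOn]
  constructor
  · rintro ⟨w', hw, ρ, ⟨h0, hs⟩, hacc⟩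
    exact ⟨ρ 0, h0, w', ρ, rfl, hs, hacc, hw⟩
  · rintro ⟨_, h0, w', ρ, rfl, hs, hacc, hw⟩
    exact ⟨w', hw, ρ, ⟨h0, hs⟩, hacc⟩

theorem infStates_succ (ρ : ℕ → Q) : infStates (fun i => ρ (i + 1)) = infStates ρ := by
  ext q
  constructor
  · intro h i
    obtain ⟨j, hj, hq⟩ := h i
    exact ⟨j + 1, by omega, hq⟩
  · intro h i
    obtain ⟨j, hj, hq⟩ := h (i + 1)
    obtain ⟨j, rfl⟩ : ∃ k, j = k + 1 := ⟨j - 1, by omega⟩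
    exact ⟨j, by omega, hq⟩

theorem infStates_add (ρ : ℕ → Q) (n : ℕ) : infStates (fun i => ρ (i + n)) = infStates ρ := by
  induction n with
  | zero => rfl
  | succ n ih =>
    rw [← ih, ← infStates_succ (fun i => ρ (i + n))]
    congr 1
    ext1 i
    congr 1
    omega

variable [DecidableEq α] {A : NFA α Q} {p q r : Q} {c : α → ℕ∞}

theorem AccFrom.cons {a : α} (hr : r ∈ A.step q a) (h : AccFrom A r c) :
    AccFrom A q (Pi.single a 1 + c) := by
  obtain ⟨w, ρ, rfl, hs, hacc, rfl⟩ := h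
  refine ⟨fun i => Nat.casesOn i a w, fun i => Nat.casesOn i q ρ, rfl, ?_, ?_, ?_⟩
  · rintro (_ | i)
    · exact hr
    · exact hs i
  · rw [← infStates_succ]
    exact hacc
  · exact parikh_eq_add_succ _

theorem AccFrom.of_path {v : α → ℕ} (hp : Path A p v q) (h : AccFrom A q c) :
    AccFrom A p ((fun a => (v a : ℕ∞)) + c) := by
  induction hp generalizing c with
  | nil =>
    convert h
    ext1 a
    simp
  | @snoc v q r a _ hr ih =>
    convert ih (h.cons hr) using 1
    rw [← add_assoc]
    congr 1
    ext1 b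
    by_cases hb : b = a
    · subst hb; simp
    · simp [hb]

theorem exists_path_of_run {w : ℕ → α} {ρ : ℕ → Q}
    (hs : ∀ i, ρ (i + 1) ∈ A.step (ρ i) (w i)) (n : ℕ) :
    ∃ v, Path A (ρ 0) v (ρ n) ∧
      parikh w = (fun a => (v a : ℕ∞)) + parikh (fun i => w (i + n)) := by
  induction n with
  | zero =>
    refine ⟨0, .nil, ?_⟩
    ext1 a
    simp
  | succ n ih =>
    obtain ⟨v, hp, hv⟩ := ih
    refine ⟨_, hp.snoc (hs n), ?_⟩
    rw [hv, parikh_eq_add_succ (fun i => w (i + n)), ← add_assoc]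
    congr 1
    · ext1 b
      by_cases hb : b = w n
      · subst hb; simp
      · simp [hb]
    · congr 1
      ext1 i
      congr 1
      omega

/-- Cut the run after the last occurrence of every letter outside `S`. The prefix may contain any
number of letters of `S`, so `v` is constrained only off `S`. -/
theorem realizes_iff [Finite α] {S : Set α} {x : α → ℕ} :
    Realizes A S x ↔ ∃ p ∈ A.start, ∃ (v : α → ℕ) (q : Q),
      Path A p v q ∧ AccFrom A q (topOn S 0) ∧ ∀ a ∉ S, v a = x a := by
  constructor
  · rintro ⟨p, hp, w, ρ, rfl, hs, hacc, hw⟩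
    have hN : ∀ a, ∃ n, a ∉ S → ∀ i ≥ n, w i ≠ a := by
      intro a
      by_cases ha : a ∈ S
      · exact ⟨0, fun h => (h ha).elim⟩
      · have : parikh w a ≠ ⊤ := by rw [hw, Ne, topOn_eq_top_iff]; exact ha
        rw [Ne, parikh_eq_top_iff] at this
        push Not at this
        obtain ⟨n, hn⟩ := this
        exact ⟨n, fun _ => hn⟩
    choose f hf using hN
    obtain ⟨n, hn⟩ := (Set.finite_range f).bddAbove
    obtain ⟨v, hv, hvw⟩ := exists_path_of_run hs n
    have hshift : parikh (fun i => w (i + n)) = topOn S 0 := by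
      ext1 a
      by_cases ha : a ∈ S
      · rw [topOn_of_mem ha]
        have := congrFun hvw a
        rw [hw, topOn_of_mem ha] at this
        simpa using this.symm
      · rw [topOn_of_notMem ha, Pi.zero_apply, Nat.cast_zero, parikh_eq_zero_iff]
        intro i
        have : f a ≤ n := hn ⟨a, rfl⟩
        exact hf a ha _ (by omega)
    refine ⟨ρ 0, hp, v, ρ n, hv, ⟨fun i => w (i + n), fun i => ρ (i + n), by simp, ?_, ?_, hshift⟩,
      ?_⟩
    · intro i
      have := hs (i + n)
      rwa [add_right_comm] at this
    · rwa [infStates_add]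
    · intro a ha
      have := congrFun hvw a
      rw [hw, hshift, Pi.add_apply, topOn_of_notMem ha, topOn_of_notMem ha] at this
      simpa using this.symm
  · rintro ⟨p, hp, v, q, hpath, hacc, hv⟩
    exact ⟨p, hp, coe_add_topOn_zero hv ▸ hacc.of_path hpath⟩

theorem isSemilinearSet_setOf_realizes [Finite α] [Finite Q] (A : NFA α Q) (S : Set α) :
    IsSemilinearSet {x | Realizes A S x} := by
  have : {x | Realizes A S x} = zeroOn S ⁻¹' ⋃ p ∈ A.start,
      ⋃ q ∈ {q | AccFrom A q (topOn S 0)}, zeroOn S '' {v | Path A p v q} := by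
    ext x
    simp only [Set.mem_ofPred_eq, realizes_iff, Set.mem_preimage, Set.mem_iUnion, Set.mem_image,
      exists_prop, zeroOn_eq_zeroOn_iff]
    constructor
    · rintro ⟨p, hp, v, q, h, h', hv⟩
      exact ⟨p, hp, q, h', v, h, hv⟩
    · rintro ⟨p, hp, q, h', v, h, hv⟩
      exact ⟨p, hp, v, q, h, h', hv⟩
  rw [this]
  refine IsSemilinearSet.preimage (.biUnion (Set.toFinite _) fun p _ =>
    .biUnion (Set.toFinite _) fun q _ => ?_) _
  exact (isSemilinearSet_setOf_path A p q).image _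

end Acceptance

/-! ### Finite unions of automata -/

section Recognizable

variable {α : Type*}

/-- The relation `F` between sets of letters and vectors is the set of Parikh images of words
accepted by some automaton. -/
def IsRecognizable (F : Set α → (α → ℕ) → Prop) : Prop :=
  ∃ (n : ℕ) (B : NFA α (Fin n)), ∀ S x, Realizes B S x ↔ F S x

theorem infStates_comp {P Q : Type*} {f : P → Q} (hf : f.Injective) (ρ : ℕ → P) (p : P) :
    f p ∈ infStates (f ∘ ρ) ↔ p ∈ infStates ρ := by
  simp [infStates, hf.eq_iff]

theorem isRecognizable_of_finite {P : Type*} [Finite P] {F : Set α → (α → ℕ) → Prop}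
    (B : NFA α P) (hB : ∀ S x, Realizes B S x ↔ F S x) : IsRecognizable F := by
  obtain ⟨n, ⟨e⟩⟩ := Finite.exists_equiv_fin P
  refine ⟨n, ⟨fun q a => e.symm ⁻¹' B.step (e.symm q) a, e.symm ⁻¹' B.start,
    e.symm ⁻¹' B.accept⟩, fun S x => ?_⟩
  rw [← hB]
  constructor
  · rintro ⟨_, hp, w, ρ, rfl, hs, ⟨q, hq, hq'⟩, hw⟩
    exact ⟨_, hp, w, e.symm ∘ ρ, rfl, hs,
      ⟨e.symm q, (infStates_comp e.symm.injective ρ q).2 hq, hq'⟩, hw⟩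
  · rintro ⟨_, hp, w, ρ, rfl, hs, ⟨q, hq, hq'⟩, hw⟩
    refine ⟨e (ρ 0), by simpa using hp, w, e ∘ ρ, rfl, by simpa using hs,
      ⟨e q, (infStates_comp e.injective ρ q).2 hq, by simpa using hq'⟩, hw⟩

theorem IsRecognizable.exists {ι : Type*} [Finite ι] {F : ι → Set α → (α → ℕ) → Prop}
    (hF : ∀ i, IsRecognizable (F i)) : IsRecognizable fun S x => ∃ i, F i S x := by
  choose n B hB using hF
  have hinj (i : ι) : Function.Injective fun s => (⟨i, s⟩ : Σ i, Fin (n i)) :=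
    sigma_mk_injective (β := fun i => Fin (n i))
  let C : NFA α (Σ i, Fin (n i)) :=
    ⟨fun q a => Sigma.mk q.1 '' (B q.1).step q.2 a, {q | q.2 ∈ (B q.1).start},
      {q | q.2 ∈ (B q.1).accept}⟩
  refine isRecognizable_of_finite C fun S x => ?_
  simp_rw [← hB]
  constructor
  · rintro ⟨_, hp, w, ρ, rfl, hs, ⟨q, hq, hq'⟩, hw⟩
    -- A run of the disjoint union never leaves the component where it starts.
    have hρ : ∀ k, ∃ s : Fin (n (ρ 0).1), ρ k = ⟨(ρ 0).1, s⟩ := by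
      intro k
      induction k with
      | zero => exact ⟨_, rfl⟩
      | succ k ih =>
        obtain ⟨s, hs'⟩ := ih
        have hk := hs k
        rw [hs'] at hk
        obtain ⟨t, _, ht⟩ := hk
        exact ⟨t, ht.symm⟩
    obtain ⟨i, hi⟩ : ∃ i, i = (ρ 0).1 := ⟨_, rfl⟩
    rw [← hi] at hρ
    choose τ hτ using hρ
    obtain rfl : ρ = fun k => ⟨i, τ k⟩ := funext hτ
    obtain ⟨j, -, rfl⟩ := hq 0
    refine ⟨i, τ 0, hp, w, τ, rfl, fun k => ?_, ⟨τ j, ?_, hq'⟩, hw⟩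
    · obtain ⟨t, ht, ht'⟩ := hs k
      rw [sigma_mk_injective ht'] at ht
      exact ht
    · exact (infStates_comp (hinj i) τ _).1 hq
  · rintro ⟨i, _, hp, w, ρ, rfl, hs, ⟨q, hq, hq'⟩, hw⟩
    exact ⟨⟨i, ρ 0⟩, hp, w, fun k => ⟨i, ρ k⟩, rfl, fun k => ⟨_, hs k, rfl⟩,
      ⟨⟨i, q⟩, (infStates_comp (hinj i) ρ q).2 hq, hq'⟩, hw⟩

end Recognizable

/-! ### An automaton for a linear set -/

section Linear

variable {α : Type*} [DecidableEq α] {k : ℕ}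

/-- An automaton for the words in which exactly the letters `e j` occur infinitely often and the
numbers of occurrences of the other letters form a vector in `b + closure T`. A state `inl r` says
that the letters counted by `r` have to be read before the next choice: of another vector of `T`,
or of the states `inr j`, which read the letters `e j` cyclically. -/
def linearNFA (e : ZMod k → α) (b : α → ℕ) (T : Set (α → ℕ)) (N : α → ℕ) :
    NFA α (Set.Iic N ⊕ ZMod k) where
  step q a := {q' | match q, q' with
    | .inl r, .inl r' =>
      (a ∉ Set.range e ∧ r.1 = r'.1 + Pi.single a 1) ∨ (a ∈ Set.range e ∧ r.1 = 0 ∧ r'.1 ∈ T)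
    | .inl r, .inr j => a ∈ Set.range e ∧ r.1 = 0 ∧ j = 0
    | .inr j, .inr j' => a = e j ∧ j' = j + 1
    | .inr _, .inl _ => False}
  start := {q | ∃ r, q = .inl r ∧ r.1 = b}
  accept := Set.range .inr

variable {e : ZMod k → α} {b : α → ℕ} {T : Set (α → ℕ)} {N : α → ℕ}

theorem inr_step_linearNFA {j : ZMod k} {a : α} {q : Set.Iic N ⊕ ZMod k} :
    q ∈ (linearNFA e b T N).step (.inr j) a ↔ a = e j ∧ q = .inr (j + 1) := by
  cases q <;> simp [linearNFA]

/-- Acceptance forces a visit to some `inr j`; from there the run is deterministic and cycles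
through `e`. -/
theorem eq_range_of_accFrom_linearNFA [NeZero k] {q : Set.Iic N ⊕ ZMod k} {S : Set α}
    {x : α → ℕ} (h : AccFrom (linearNFA e b T N) q (topOn S x)) : S = Set.range e := by
  obtain ⟨w, ρ, -, hs, ⟨_, hq, j, rfl⟩, hw⟩ := h
  obtain ⟨m, -, hm⟩ := hq 0
  have hρ : ∀ i : ℕ, ρ (m + i) = .inr (j + i) := by
    intro i
    induction i with
    | zero => simpa using hm
    | succ i ih =>
      have := hs (m + i)
      rw [ih, inr_step_linearNFA] at this
      rw [← add_assoc, this.2]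
      push_cast
      rw [add_assoc]
  have hwe : ∀ i : ℕ, w (m + i) = e (j + i) := by
    intro i
    have := hs (m + i)
    rw [hρ, inr_step_linearNFA] at this
    exact this.1
  ext a
  rw [← topOn_eq_top_iff (x := x), ← hw, parikh_eq_top_iff]
  constructor
  · intro h
    obtain ⟨i, hi, rfl⟩ := h m
    obtain ⟨i, rfl⟩ := Nat.exists_eq_add_of_le hi
    exact ⟨_, (hwe i).symm⟩
  · rintro ⟨l, rfl⟩ n
    -- The offset is `l - j` modulo `k`; the multiple `k * n` pushes the position past `n`.
    refine ⟨m + ((l - j).val + k * n), ?_, ?_⟩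
    · have : 1 * n ≤ k * n := Nat.mul_le_mul_right n (NeZero.pos k)
      omega
    · rw [hwe]
      simp

theorem accFrom_linearNFA_inr [NeZero k] (j : ZMod k) :
    AccFrom (linearNFA e b T N) (.inr j) (topOn (Set.range e) 0) := by
  refine ⟨fun i => e (j + i), fun i => .inr (j + i), by simp, fun i => ?_, ?_, ?_⟩
  · rw [inr_step_linearNFA]
    simp [add_assoc]
  · refine ⟨.inr j, fun i => ⟨k * (i + 1), ?_, by simp⟩, j, rfl⟩
    have : 1 * (i + 1) ≤ k * (i + 1) := Nat.mul_le_mul_right _ (NeZero.pos k)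
    omega
  · ext1 a
    by_cases ha : a ∈ Set.range e
    · rw [topOn_of_mem ha, parikh_eq_top_iff]
      obtain ⟨l, rfl⟩ := ha
      refine fun n => ⟨(l - j).val + k * n, ?_, by simp⟩
      have : 1 * n ≤ k * n := Nat.mul_le_mul_right n (NeZero.pos k)
      omega
    · rw [topOn_of_notMem ha, Pi.zero_apply, Nat.cast_zero, parikh_eq_zero_iff]
      exact fun i h => ha ⟨_, h⟩

theorem eq_zero_of_accFrom_linearNFA_inl {r : Set.Iic N}
    (h : AccFrom (linearNFA e b T N) (.inl r) (topOn (Set.range e) 0)) : r.1 = 0 := by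
  obtain ⟨w, ρ, h0, hs, -, hw⟩ := h
  have hmem : w 0 ∈ Set.range e := by
    by_contra h
    have := congrFun hw (w 0)
    rw [topOn_of_notMem h, Pi.zero_apply, Nat.cast_zero, parikh_eq_zero_iff] at this
    exact this 0 rfl
  have := hs 0
  rw [h0] at this
  rcases h1 : ρ (0 + 1) with r' | j
  · rw [h1] at this
    rcases this with h | h
    · exact (h.1 hmem).elim
    · exact h.2.1
  · rw [h1] at this
    exact this.2.1

/-- Invariant off `Set.range e`: letters read plus letters still owed equal `b` plus the vectors of
`T` chosen so far. -/
theorem exists_mem_of_path_linearNFA {r₀ : Set.Iic N} (hr₀ : r₀.1 = b) {v : α → ℕ}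
    {q : Set.Iic N ⊕ ZMod k} (h : Path (linearNFA e b T N) (.inl r₀) v q) :
    ∃ y ∈ AddSubmonoid.closure T, ∀ a ∉ Set.range e,
      v a + Sum.elim (fun r : Set.Iic N => r.1 a) (fun _ => 0) q = b a + y a := by
  induction h with
  | nil => exact ⟨0, zero_mem _, by simp [hr₀]⟩
  | @snoc v q q' c _ hq ih =>
    obtain ⟨y, hy, hv⟩ := ih
    have hne : c ∈ Set.range e → ∀ a ∉ Set.range e, (v + Pi.single c 1 : α → ℕ) a = v a := by
      intro hc a ha
      have : a ≠ c := fun h => ha (h ▸ hc)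
      simp [this]
    rcases q with r | j <;> rcases q' with r' | j'
    · rcases hq with ⟨hc, hr⟩ | ⟨hc, hr, hT⟩
      · refine ⟨y, hy, fun a ha => ?_⟩
        rw [← hv a ha]
        simp only [Sum.elim_inl, hr, Pi.add_apply]
        by_cases hac : a = c
        · subst hac; simp; omega
        · simp [hac]
      · refine ⟨y + r'.1, add_mem hy (AddSubmonoid.subset_closure hT), fun a ha => ?_⟩
        rw [hne hc a ha, Pi.add_apply, ← add_assoc, ← hv a ha]
        simp [hr]
    · obtain ⟨hc, hr, -⟩ := hq
      refine ⟨y, hy, fun a ha => ?_⟩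
      rw [hne hc a ha, ← hv a ha]
      simp [hr]
    · exact hq.elim
    · refine ⟨y, hy, fun a ha => ?_⟩
      rw [hne ⟨j, hq.1.symm⟩ a ha, ← hv a ha]
      simp

theorem path_linearNFA_inl_zero [Finite α] (r : Set.Iic N) (hr : ∀ a ∈ Set.range e, r.1 a = 0) :
    Path (linearNFA e b T N) (.inl r) r.1 (.inl ⟨0, by simp⟩) := by
  suffices ∀ (u : α → ℕ) (r' : Set.Iic N), r.1 = u + r'.1 →
      Path (linearNFA e b T N) (.inl r) u (.inl r') from this _ _ (by simp)
  intro u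
  induction u using WellFoundedLT.induction with
  | _ u ih =>
    intro r' h
    by_cases hu : u = 0
    · subst hu
      obtain rfl : r = r' := Subtype.ext (by simpa using h)
      exact .nil
    · obtain ⟨a, ha⟩ := Function.ne_iff.1 hu
      have hle : Pi.single a 1 ≤ u := by
        intro c
        by_cases hc : c = a
        · subst hc
          simpa using Nat.one_le_iff_ne_zero.2 ha
        · simp [hc]
      obtain ⟨u', rfl⟩ := exists_add_of_le hle
      rw [add_comm (Pi.single a 1)] at h ⊢
      have h' : r.1 = u' + (r'.1 + Pi.single a 1) := by rw [h, add_assoc, add_comm r'.1]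
      -- The intermediate debt stays below `r`, so it is still a state.
      have hN : r'.1 + Pi.single a 1 ≤ N := (h' ▸ le_add_self).trans r.2
      refine (ih u' ?_ ⟨_, hN⟩ h').snoc (.inl ⟨fun hae => ?_, rfl⟩)
      · exact lt_add_of_pos_left _ (Pi.single_pos.2 one_pos)
      · have := hr a hae
        rw [h'] at this
        simp at this

theorem exists_path_linearNFA [Finite α] {r₀ : Set.Iic N} (hr₀ : r₀.1 = b)
    (hb : ∀ a ∈ Set.range e, b a = 0) (hT : ∀ t ∈ T, ∀ a ∈ Set.range e, t a = 0)
    (hTN : ∀ t ∈ T, t ≤ N) (s : ZMod k) {y : α → ℕ} (hy : y ∈ AddSubmonoid.closure T) :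
    ∃ v, Path (linearNFA e b T N) (.inl r₀) v (.inl ⟨0, by simp⟩) ∧
      ∀ a ∉ Set.range e, v a = b a + y a := by
  induction hy using AddSubmonoid.closure_induction_right with
  | zero => exact ⟨b, hr₀ ▸ path_linearNFA_inl_zero r₀ (hr₀ ▸ hb), by simp⟩
  | add_right y _ t ht ih =>
    obtain ⟨v, hv, hvy⟩ := ih
    -- Choosing `t` costs one letter `e s`, which is invisible off `Set.range e`.
    refine ⟨v + Pi.single (e s) 1 + t, (hv.snoc (r := .inl ⟨t, hTN t ht⟩) ?_).trans
      (path_linearNFA_inl_zero ⟨t, hTN t ht⟩ (hT t ht)), fun a ha => ?_⟩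
    · exact .inr ⟨⟨s, rfl⟩, rfl, ht⟩
    · have : a ≠ e s := fun h => ha ⟨s, h.symm⟩
      simp [this, hvy a ha, add_assoc]

theorem realizes_linearNFA_iff [Finite α] [NeZero k] (hb : ∀ a ∈ Set.range e, b a = 0)
    (hT : ∀ t ∈ T, ∀ a ∈ Set.range e, t a = 0) (hbN : b ≤ N) (hTN : ∀ t ∈ T, t ≤ N) {S : Set α}
    {x : α → ℕ} :
    Realizes (linearNFA e b T N) S x ↔
      S = Set.range e ∧ zeroOn S x ∈ b +ᵥ (AddSubmonoid.closure T : Set (α → ℕ)) := by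
  have hcl : ∀ y ∈ AddSubmonoid.closure T, ∀ a ∈ Set.range e, y a = 0 := by
    intro y hy a ha
    induction hy using AddSubmonoid.closure_induction with
    | mem t ht => exact hT t ht a ha
    | zero => rfl
    | add y z _ _ hy hz => simp [hy, hz]
  have hmem : zeroOn (Set.range e) x ∈ b +ᵥ (AddSubmonoid.closure T : Set (α → ℕ)) ↔
      ∃ y ∈ AddSubmonoid.closure T, ∀ a ∉ Set.range e, x a = b a + y a := by
    rw [Set.mem_vadd_set]
    refine exists_congr fun y => and_congr_right fun hy => ?_
    have : b +ᵥ y = zeroOn (Set.range e) (b + y) := by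
      ext1 a
      by_cases ha : a ∈ Set.range e
      · simp [zeroOn_of_mem _ ha, hb a ha, hcl y hy a ha]
      · simp [zeroOn_of_notMem _ ha]
    rw [this, eq_comm, zeroOn_eq_zeroOn_iff]
    rfl
  constructor
  · intro h
    obtain ⟨p, -, h'⟩ := id h
    obtain rfl := eq_range_of_accFrom_linearNFA h'
    refine ⟨rfl, hmem.2 ?_⟩
    obtain ⟨_, ⟨r₀, rfl, hr₀⟩, v, q, hpath, hacc, hv⟩ := realizes_iff.1 h
    obtain ⟨y, hy, hvy⟩ := exists_mem_of_path_linearNFA hr₀ hpath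
    refine ⟨y, hy, fun a ha => ?_⟩
    rw [← hv a ha, ← hvy a ha]
    rcases q with r | j
    · simp [eq_zero_of_accFrom_linearNFA_inl hacc]
    · simp
  · rintro ⟨rfl, h⟩
    obtain ⟨y, hy, hx⟩ := hmem.1 h
    obtain ⟨v, hpath, hv⟩ :=
      exists_path_linearNFA (r₀ := ⟨b, hbN⟩) rfl hb hT hTN 0 hy
    refine realizes_iff.2 ⟨_, ⟨⟨b, hbN⟩, rfl, rfl⟩, v + Pi.single (e 0) 1, .inr 0,
      hpath.snoc ⟨⟨0, rfl⟩, rfl, rfl⟩, accFrom_linearNFA_inr 0, fun a ha => ?_⟩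
    have : a ≠ e 0 := fun h => ha ⟨0, h.symm⟩
    simp [this, hx a ha, hv a ha]

end Linear

/-! ### From semilinear sets to automata, and the complement -/

section Complement

variable {α : Type*} [Finite α]

theorem isRecognizable_of_isLinearSet {S₀ : Set α} (hS₀ : S₀.Nonempty) {X : Set (α → ℕ)}
    (hX : IsLinearSet X) :
    IsRecognizable fun S x => S = S₀ ∧ zeroOn S x ∈ zeroOn S₀ '' X := by
  classical
  have := hS₀.to_subtype
  have : NeZero (Nat.card S₀) := ⟨Nat.card_pos.ne'⟩
  obtain ⟨f⟩ : Nonempty (ZMod (Nat.card S₀) ≃ S₀) := Finite.card_eq.1 (Nat.card_zmod _)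
  let e : ZMod (Nat.card S₀) → α := fun j => f j
  have he : Set.range e = S₀ := by
    rw [show e = Subtype.val ∘ f from rfl, f.surjective.range_comp, Subtype.range_val]
  obtain ⟨b, T, hT, rfl⟩ := hX
  obtain ⟨N, hN⟩ := ((hT.image (zeroOn S₀)).insert (zeroOn S₀ b)).bddAbove
  have := Fintype.ofFinite α
  have : Finite (Set.Iic N) := (Set.finite_Iic N).to_subtype
  refine isRecognizable_of_finite (linearNFA e (zeroOn S₀ b) (zeroOn S₀ '' T) N) fun S x => ?_
  rw [realizes_linearNFA_iff, he]
  · refine and_congr_right fun _ => ?_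
    simp [Set.image_vadd_distrib, ← AddMonoidHom.map_mclosure]
  · exact fun a ha => zeroOn_of_mem _ (he ▸ ha)
  · rintro _ ⟨t, _, rfl⟩ a ha
    exact zeroOn_of_mem _ (he ▸ ha)
  · exact hN (Set.mem_insert _ _)
  · exact fun t ht => hN (Set.mem_insert_of_mem _ ht)

theorem isRecognizable_of_isSemilinearSet {S₀ : Set α} (hS₀ : S₀.Nonempty) {X : Set (α → ℕ)}
    (hX : IsSemilinearSet X) :
    IsRecognizable fun S x => S = S₀ ∧ zeroOn S x ∈ zeroOn S₀ '' X := by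
  obtain ⟨𝒳, h𝒳, hlin, rfl⟩ := hX
  have := h𝒳.to_subtype
  have := IsRecognizable.exists fun X : 𝒳 => isRecognizable_of_isLinearSet hS₀ (hlin X X.2)
  convert this using 4 with S x
  rw [Set.image_sUnion]
  simp

end Complement

end JumpingAutomata

theorem mainTheorem3 {α : Type*} [Finite α] {Q : Type*} [Finite Q] (A : NFA α Q) :
    ∃ (P : Type) (_ : Finite P) (B : NFA α P),
      JumpingAutomata.jumpingLanguage B = (JumpingAutomata.jumpingLanguage A)ᶜ := by
  open JumpingAutomata in
  classical
  have hrec (S₀ : {S : Set α // S.Nonempty}) :=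
    isRecognizable_of_isSemilinearSet S₀.2 (isSemilinearSet_setOf_realizes A S₀.1).compl
  obtain ⟨n, B, hB⟩ := IsRecognizable.exists hrec
  refine ⟨Fin n, inferInstance, B, ?_⟩
  ext w
  rw [mem_jumpingLanguage_iff, hB, Set.mem_compl_iff, mem_jumpingLanguage_iff]
  constructor
  · rintro ⟨⟨_, _⟩, rfl, y, hy, hyx⟩ h
    rw [zeroOn_eq_zeroOn_iff] at hyx
    -- `y` agrees with the counts of `w` off `S`, and `Realizes` ignores the entries in `S`, so `y`
    -- would be realized too.
    refine hy ?_
    rw [Set.mem_ofPred_eq]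
    rw [realizes_iff] at h ⊢
    obtain ⟨p, hp, v, q, h1, h2, h3⟩ := h
    exact ⟨p, hp, v, q, h1, h2, fun a ha => (h3 a ha).trans (hyx a ha).symm⟩
  · intro h
    exact ⟨⟨_, exists_parikh_eq_top w⟩, rfl, _, h, rfl⟩
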